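/- Let $A$ be a unital $C^*$-algebra and let $X$ be a (right) Hilbert $A$-module, i.e. a right $A$-module with an $A$-valued inner product $\langle\cdot,\cdot\rangle$ that is $\mathbb C$-linear and $A$-linear in the second variable ($\langle x,ya\rangle=\langle x,y\rangle a$), satisfies $\langle y,x\rangle=\langle x,y\rangle^*$ and $\langle x,x\rangle\ge 0$ with equality only for $x=0$, and is complete for the norm $\|x\|=\|\langle x,x\rangle\|^{1/2}$. Let $\{x_j\}_{j\in J}$ be a family of elements of $X$. Call it a frame of $X$ if there is a real constant $C>0$ such that, for every $x\in X$, the sum $\sum_{j\in J}\langle x,x_j\rangle\langle x_j,x\rangle$ (the limit of the net of its finite partial sums) converges in the ultraweak operator topology to some element of the universal enveloping von Neumann algebra $A^{**}$ of $A$ (the double commutant of the image of $A$ under its universal representation, the direct sum of the GNS representations of all states of $A$), and $$C\langle x,x\rangle\le\sum_{j\in J}\langle x,x_j\rangle\langle x_j,x\rangle\le C^{-1}\langle x,x\rangle\quad\text{in } A^{**}.$$ Then $\{x_j\}_{j\in J}$ is a frame of $X$ if and only if there is a real constant $C>0$ such that, for every $x\in X$ and every state $\varphi$ of $A$, the series $\sum_{j\in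 J}\varphi(\langle x,x_j\rangle\langle x_j,x\rangle)$ converges and $$C\,\varphi(\langle x,x\rangle)\le\sum_{j\in J}\varphi(\langle x,x_j\rangle\langle x_j,x\rangle)\le C^{-1}\varphi(\langle x,x\rangle).$$ -/

import Mathlib

open Filter Topology
open scoped ComplexOrder InnerProductSpace

/-- A (right) Hilbert `A`-module over a unital C⋆-algebra `A`: a right `A`-module `X`
(i.e. a module over `Aᵐᵒᵖ`; `MulOpposite.op a • y` is the right multiplication `y a`) with an
`A`-valued inner product, complete for the norm `‖x‖ = ‖⟨x, x⟩‖^(1/2)`.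

(Mathlib's `CStarModule` is not used because its `A`-action is a left one, with
`⟨x, a y⟩ = a ⟨x, y⟩`.) -/
class RightHilbertModule (A X : Type*) [CStarAlgebra A] [PartialOrder A]
    [NormedAddCommGroup X] [Module ℂ X] [Module Aᵐᵒᵖ X] extends Inner A X where
  inner_add_right (x y z : X) : inner x (y + z) = inner x y + inner x z
  inner_smul_right (c : ℂ) (x y : X) : inner x (c • y) = c • inner x y
  inner_op_smul_right (x y : X) (a : A) : inner x (MulOpposite.op a • y) = inner x y * a
  star_inner (x y : X) : star (inner x y) = inner y x
  inner_self_nonneg (x : X) : 0 ≤ inner x x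
  inner_self_eq_zero (x : X) : inner x x = 0 → x = 0
  norm_eq_sqrt_norm_inner_self (x : X) : ‖x‖ = √‖inner x x‖
  complete : CompleteSpace X

section Defs

variable (A : Type*) [CStarAlgebra A] [PartialOrder A]

/-- The states of a unital C⋆-algebra: the positive linear functionals `φ` with `φ 1 = 1`. -/
def CStarState : Type _ := {φ : A →ₚ[ℂ] ℂ // φ 1 = 1}

variable [StarOrderedRing A]

/-- The Hilbert space of the universal representation of `A`: the Hilbert space direct sum of the
Gelfand–Naimark–Segal spaces of all the states of `A`. -/
noncomputable abbrev UniversalSpace : Type _ := lp (fun φ : CStarState A => φ.1.GNS) 2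

variable {A}

theorem norm_gnsStarAlgHom_apply_le (φ : A →ₚ[ℂ] ℂ) (a : A) (v : φ.GNS) :
    ‖φ.gnsStarAlgHom a v‖ ≤ ‖(‖a‖ : ℂ) • v‖ := by
  rw [norm_smul]
  refine (ContinuousLinearMap.le_opNorm _ v).trans ?_
  simpa using mul_le_mul_of_nonneg_right
    (NonUnitalStarAlgHom.norm_apply_le φ.gnsStarAlgHom a) (norm_nonneg v)

/-- The operator of `a` in the universal representation: `(v_φ)_φ ↦ (π_φ(a) v_φ)_φ`, where `π_φ`
is the Gelfand–Naimark–Segal representation of the state `φ`. -/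
noncomputable def universalRepCLM (a : A) : UniversalSpace A →L[ℂ] UniversalSpace A :=
  LinearMap.mkContinuous
    { toFun := fun v => ⟨fun φ => φ.1.gnsStarAlgHom a (v φ),
        (lp.memℓp ((‖a‖ : ℂ) • v)).mono' fun φ => norm_gnsStarAlgHom_apply_le φ.1 a (v φ)⟩
      map_add' := fun v w => by ext φ; exact map_add (φ.1.gnsStarAlgHom a) (v φ) (w φ)
      map_smul' := fun c v => by ext φ; simp }
    ‖a‖ fun v => by
      refine (lp.norm_mono (y := (‖a‖ : ℂ) • v) two_ne_zero
        fun φ => norm_gnsStarAlgHom_apply_le φ.1 a (v φ)).trans ?_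
      rw [norm_smul, Complex.norm_real, norm_norm]

@[simp]
theorem universalRepCLM_apply (a : A) (v : UniversalSpace A) (φ : CStarState A) :
    universalRepCLM a v φ = φ.1.gnsStarAlgHom a (v φ) := rfl

variable (A)

/-- The universal representation of `A`, the direct sum of the Gelfand–Naimark–Segal
representations of all the states of `A`. -/
noncomputable def universalRep : A →⋆ₐ[ℂ] (UniversalSpace A →L[ℂ] UniversalSpace A) where
  toFun := universalRepCLM
  map_one' := by ext v φ; simp
  map_mul' a b := by ext v φ; simp
  map_zero' := by ext v φ; simp
  map_add' a b := by ext v φ; simp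
  commutes' c := by
    ext v φ
    simp [Algebra.algebraMap_eq_smul_one]
  map_star' a := by
    refine (ContinuousLinearMap.eq_adjoint_iff _ _).mpr fun v w => ?_
    simp only [lp.inner_eq_tsum, universalRepCLM_apply, map_star,
      ContinuousLinearMap.star_eq_adjoint, ContinuousLinearMap.adjoint_inner_left]

/-- The universal enveloping von Neumann algebra `A**` of `A`: the double commutant of the image
of the universal representation. -/
noncomputable def universalEnvelopingVonNeumannAlgebra :
    VonNeumannAlgebra (UniversalSpace A) where
  toStarSubalgebra := StarSubalgebra.centralizer ℂ
    (StarSubalgebra.centralizer ℂ (Set.range (universalRep A)) : Set _)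
  centralizer_centralizer' := by
    simp

theorem coe_universalEnvelopingVonNeumannAlgebra :
    (universalEnvelopingVonNeumannAlgebra A : Set (UniversalSpace A →L[ℂ] UniversalSpace A)) =
      Set.centralizer (Set.centralizer (Set.range (universalRep A))) := by
  have h : star (Set.range (universalRep A)) = Set.range (universalRep A) := by
    ext T
    refine ⟨fun ⟨a, ha⟩ => ⟨star a, ?_⟩, fun ⟨a, ha⟩ => ⟨star a, ?_⟩⟩
    · rw [map_star, ha, star_star]
    · rw [map_star, ha]
  simp [universalEnvelopingVonNeumannAlgebra, h, Set.star_centralizer]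

end Defs

/-- The ultraweak operator topology on `B(H)`: the coarsest topology for which all the functionals
`T ↦ ∑ₙ ⟨ηₙ, T ξₙ⟩` with `∑ₙ ‖ξₙ‖² < ∞` and `∑ₙ ‖ηₙ‖² < ∞` are continuous. -/
@[reducible]
noncomputable def ultraweakTopology (H : Type*) [NormedAddCommGroup H] [InnerProductSpace ℂ H] :
    TopologicalSpace (H →L[ℂ] H) :=
  ⨅ (ξ : lp (fun _ : ℕ => H) 2) (η : lp (fun _ : ℕ => H) 2),
    TopologicalSpace.induced (fun T => ∑' n, ⟪η n, T (ξ n)⟫_ℂ) inferInstance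

/-- The family `x` is a frame of the Hilbert `A`-module `X`: for some real `C > 0` and all `y`,
the net of finite partial sums of `∑ⱼ ⟨y, xⱼ⟩ ⟨xⱼ, y⟩` converges in the ultraweak operator topology
to an element `s` of `A**`, and `C ⟨y, y⟩ ≤ s ≤ C⁻¹ ⟨y, y⟩` in `A**` (with `A` mapped to `A**` by
its universal representation, and operators ordered by positivity). -/
def IsHilbertModuleFrame (A : Type*) {X J : Type*} [CStarAlgebra A] [PartialOrder A]
    [StarOrderedRing A] [NormedAddCommGroup X] [Module ℂ X] [Module Aᵐᵒᵖ X]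
    [RightHilbertModule A X] (x : J → X) : Prop :=
  ∃ C : ℝ, 0 < C ∧ ∀ y : X, ∃ s ∈ universalEnvelopingVonNeumannAlgebra A,
    Tendsto (fun F : Finset J => ∑ j ∈ F, universalRep A (⟪y, x j⟫_A * ⟪x j, y⟫_A)) atTop
      (@nhds _ (ultraweakTopology (UniversalSpace A)) s) ∧
    universalRep A (C • ⟪y, y⟫_A) ≤ s ∧ s ≤ universalRep A (C⁻¹ • ⟪y, y⟫_A)

/-! ### Weak, strong and ultraweak limits of operators on a Hilbert space. -/

section Operators

variable {H : Type*} [NormedAddCommGroup H] [InnerProductSpace ℂ H]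

/-! Both conditions hold with the same `C`, so `y` can be fixed and only the positive elements `b j
= ⟪y, x j⟫ * ⟪x j, y⟫` matter (`exists_ultraweak_sum_iff`). Every state is a vector functional of
the universal representation `π`, and every vector functional of `π` is a nonnegative multiple of a
state; hence order relations between operators, being relations between quadratic forms, can be
tested on states. Ultraweak convergence yields the state sums by evaluation at vectors. Conversely,
the upper bounds on states give `∑ j ∈ F, π (b j) ≤ π d` for all finite `F`, so the positive series
converges strongly. Its sum commutes with the commutant of `π(A)`, hence lies in `A**`, and the
uniform norm bound on the partial sums makes the convergence ultraweak. -/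

theorem tendsto_nhds_ultraweakTopology_iff {ι : Type*} {l : Filter ι} {T : ι → H →L[ℂ] H}
    {S : H →L[ℂ] H} :
    Tendsto T l (@nhds _ (ultraweakTopology H) S) ↔
      ∀ ξ η : lp (fun _ : ℕ => H) 2,
        Tendsto (fun i => ∑' n, ⟪η n, T i (ξ n)⟫_ℂ) l (𝓝 (∑' n, ⟪η n, S (ξ n)⟫_ℂ)) := by
  simp only [nhds_iInf, tendsto_iInf, nhds_induced, tendsto_comap_iff,
    Function.comp_def]

theorem tendsto_inner_of_tendsto_ultraweakTopology {ι : Type*} {l : Filter ι}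
    {T : ι → H →L[ℂ] H} {S : H →L[ℂ] H} (h : Tendsto T l (@nhds _ (ultraweakTopology H) S))
    (v w : H) : Tendsto (fun i => ⟪v, T i w⟫_ℂ) l (𝓝 ⟪v, S w⟫_ℂ) := by
  -- Sequences supported at index `0` turn an ultraweak functional into a matrix coefficient.
  have key (R : H →L[ℂ] H) :
      ∑' n, ⟪(lp.single 2 0 v : lp (fun _ : ℕ => H) 2) n,
        R ((lp.single 2 0 w : lp (fun _ : ℕ => H) 2) n)⟫_ℂ = ⟪v, R w⟫_ℂ := by
    rw [tsum_eq_single 0 fun n hn => by rw [lp.single_apply_ne _ _ _ hn, inner_zero_left]]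
    simp only [lp.single_apply_self]
  simpa only [key] using tendsto_nhds_ultraweakTopology_iff.1 h (lp.single 2 0 w) (lp.single 2 0 v)

/-- Dominated convergence: the terms are bounded by `M * ‖η n‖ * ‖ξ n‖`, summable by Cauchy–Schwarz.
-/
theorem tendsto_ultraweakTopology_of_bounded {ι : Type*} {l : Filter ι}
    {T : ι → H →L[ℂ] H} {S : H →L[ℂ] H} {M : ℝ} (hM : ∀ i, ‖T i‖ ≤ M)
    (h : ∀ v w : H, Tendsto (fun i => ⟪v, T i w⟫_ℂ) l (𝓝 ⟪v, S w⟫_ℂ)) :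
    Tendsto T l (@nhds _ (ultraweakTopology H) S) := by
  refine tendsto_nhds_ultraweakTopology_iff.2 fun ξ η => ?_
  have hs : Summable fun n => ‖η n‖ * (M * ‖ξ n‖) := by
    have := (lp.summable_mul (by rw [Real.holderConjugate_iff]; norm_num) η ξ).mul_left M
    exact this.congr fun n => by ring
  refine tendsto_tsum_of_dominated_convergence hs (fun n => h _ _)
    (Eventually.of_forall fun i n => (norm_inner_le_norm _ _).trans ?_)
  gcongr
  exact (T i).le_of_opNorm_le (hM i) _

/-- The order on `ℂ` forces the difference of the two sides to be real, which is what supplies the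
symmetry of `T - S`. -/
theorem le_iff_forall_inner_le {S T : H →L[ℂ] H} :
    S ≤ T ↔ ∀ v, ⟪v, S v⟫_ℂ ≤ ⟪v, T v⟫_ℂ := by
  refine ⟨fun h v => ?_, fun h => ?_⟩
  · have := ContinuousLinearMap.IsPositive.inner_nonneg_right h v
    rwa [sub_apply, inner_sub_right, sub_nonneg] at this
  · refine (ContinuousLinearMap.isPositive_iff_complex (T - S)).2 fun v => ?_
    have h1 : 0 ≤ ⟪v, (T - S) v⟫_ℂ := by
      rw [sub_apply, inner_sub_right, sub_nonneg]
      exact h v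
    have h2 : ⟪(T - S) v, v⟫_ℂ = ⟪v, (T - S) v⟫_ℂ := by
      rw [← inner_conj_symm, Complex.conj_eq_iff_im]
      exact (Complex.nonneg_iff.1 h1).2.symm
    rw [h2]
    exact ⟨Complex.conj_eq_iff_re.1 (Complex.conj_eq_iff_im.2 (Complex.nonneg_iff.1 h1).2.symm), (Complex.nonneg_iff.1 h1).1⟩

variable [CompleteSpace H]

theorem commute_of_tendsto_inner {ι : Type*} {l : Filter ι} [l.NeBot] {T : ι → H →L[ℂ] H}
    {R S : H →L[ℂ] H} (hT : ∀ i, Commute (T i) R)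
    (h : ∀ v w, Tendsto (fun i => ⟪v, T i w⟫_ℂ) l (𝓝 ⟪v, S w⟫_ℂ)) : Commute S R := by
  ext1 w
  refine ext_inner_left ℂ fun v => ?_
  -- Moving `R` to the left vector exhibits `⟪v, R (S w)⟫` as a limit of the same net as `⟪v, S (R
  -- w)⟫`.
  have h1 := h (ContinuousLinearMap.adjoint R v) w
  simp only [ContinuousLinearMap.adjoint_inner_left] at h1
  refine tendsto_nhds_unique (h v (R w)) (h1.congr fun i => ?_)
  exact congrArg (fun Q => ⟪v, Q w⟫_ℂ) (hT i).eq.symm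

/-- Lets smallness of the quadratic form at `v` control the norm of `T v`, which upgrades weak to
strong convergence. -/
theorem norm_apply_sq_le_of_nonneg {T : H →L[ℂ] H} (hT : 0 ≤ T) (v : H) :
    ‖T v‖ ^ 2 ≤ ‖T‖ * (⟪v, T v⟫_ℂ).re := by
  obtain ⟨S, rfl⟩ := CStarAlgebra.nonneg_iff_eq_star_mul_self.1 hT
  have h : ⟪v, (star S * S) v⟫_ℂ = (‖S v‖ : ℂ) ^ 2 := by
    rw [mul_apply_eq_comp, ContinuousLinearMap.star_eq_adjoint,
      ContinuousLinearMap.adjoint_inner_right, inner_self_eq_norm_sq_to_K]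
    rfl
  have h' : ‖(star S * S) v‖ ≤ ‖S‖ * ‖S v‖ := by
    simpa using (star S).le_opNorm (S v)
  rw [h, CStarRing.norm_star_mul_self, ← Complex.ofReal_pow, Complex.ofReal_re]
  calc _ ≤ (‖S‖ * ‖S v‖) ^ 2 := by gcongr
    _ = _ := by ring

theorem summable_apply_of_nonneg_of_sum_le {J : Type*} {T : J → H →L[ℂ] H} {B : H →L[ℂ] H}
    (hT : ∀ j, 0 ≤ T j) (hB : ∀ F : Finset J, ∑ j ∈ F, T j ≤ B) (v : H) :
    Summable fun j => T j v := by
  classical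
  have hsum (F : Finset J) : 0 ≤ ∑ j ∈ F, T j := Finset.sum_nonneg fun j _ => hT j
  have hre (F : Finset J) :
      ∑ j ∈ F, (⟪v, T j v⟫_ℂ).re = (⟪v, (∑ j ∈ F, T j) v⟫_ℂ).re := by
    rw [sum_apply, inner_sum, Complex.re_sum]
  have h0 (j : J) : 0 ≤ (⟪v, T j v⟫_ℂ).re :=
    ((ContinuousLinearMap.nonneg_iff_isPositive _).1 (hT j)).re_inner_nonneg_right v
  have hs : Summable fun j => (⟪v, T j v⟫_ℂ).re := by
    refine summable_of_sum_le h0 (c := (⟪v, B v⟫_ℂ).re) fun F => ?_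
    have := (hB F).re_inner_nonneg_right v
    rw [sub_apply, inner_sub_right, map_sub] at this
    rw [hre]
    exact sub_nonneg.1 this
  rw [summable_iff_vanishing_norm]
  intro ε hε
  -- The `+ 1` keeps the denominator positive when `B = 0`.
  obtain ⟨s, hs⟩ := summable_iff_vanishing_norm.1 hs (ε ^ 2 / (‖B‖ + 1)) (by positivity)
  refine ⟨s, fun t ht => ?_⟩
  have h1 := hs t ht
  rw [hre] at h1
  have h2 := norm_apply_sq_le_of_nonneg (hsum t) v
  rw [← sum_apply]
  refine lt_of_pow_lt_pow_left₀ 2 hε.le (h2.trans_lt ?_)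
  have h3 : ‖∑ j ∈ t, T j‖ ≤ ‖B‖ + 1 :=
    (CStarAlgebra.norm_le_norm_of_nonneg_of_le (hsum t) (hB t)).trans (by linarith)
  have h4 : (⟪v, (∑ j ∈ t, T j) v⟫_ℂ).re < ε ^ 2 / (‖B‖ + 1) := (le_abs_self _).trans_lt h1
  have h5 : 0 ≤ (⟪v, (∑ j ∈ t, T j) v⟫_ℂ).re := by
    rw [← hre]; exact Finset.sum_nonneg fun j _ => h0 j
  calc _ ≤ (‖B‖ + 1) * (⟪v, (∑ j ∈ t, T j) v⟫_ℂ).re := by gcongr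
    _ < (‖B‖ + 1) * (ε ^ 2 / (‖B‖ + 1)) := by gcongr
    _ = ε ^ 2 := by field_simp

/-- A family of positive operators with bounded partial sums is strongly summable. -/
theorem exists_hasSum_apply_of_nonneg_of_sum_le {J : Type*} {T : J → H →L[ℂ] H} {B : H →L[ℂ] H}
    (hT : ∀ j, 0 ≤ T j) (hB : ∀ F : Finset J, ∑ j ∈ F, T j ≤ B) :
    ∃ S : H →L[ℂ] H, ∀ v, HasSum (fun j => T j v) (S v) := by
  have hs := summable_apply_of_nonneg_of_sum_le hT hB
  refine ⟨LinearMap.mkContinuous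
    { toFun := fun v => ∑' j, T j v
      map_add' := fun v w => by simp only [map_add, (hs v).tsum_add (hs w)]
      map_smul' := fun c v => by simp only [map_smul, RingHom.id_apply, (hs v).tsum_const_smul] }
    ‖B‖ fun v => ?_, fun v => (hs v).hasSum⟩
  refine le_of_tendsto (hs v).hasSum.norm (Eventually.of_forall fun F => ?_)
  rw [← sum_apply]
  exact ContinuousLinearMap.le_of_opNorm_le _ (CStarAlgebra.norm_le_norm_of_nonneg_of_le
    (Finset.sum_nonneg fun j _ => hT j) (hB F)) v

end Operators

/-! ### States as vector functionals, and sums in `A**`. -/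

section UniversalRep

variable {A : Type*} [CStarAlgebra A] [PartialOrder A] [StarOrderedRing A]

/-- The vector functional `a ↦ ⟨v, π(a) v⟩` of the universal representation `π`. -/
noncomputable def universalVectorFunctional (v : UniversalSpace A) : A →ₚ[ℂ] ℂ :=
  PositiveLinearMap.mk₀
    { toFun := fun a => ⟪v, universalRep A a v⟫_ℂ
      map_add' := fun a b => by simp
      map_smul' := fun c a => by simp }
    fun _ ha => ((ContinuousLinearMap.nonneg_iff_isPositive _).1
      (map_nonneg (universalRep A) ha)).inner_nonneg_right v

theorem universalVectorFunctional_apply (v : UniversalSpace A) (a : A) :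
    universalVectorFunctional v a = ⟪v, universalRep A a v⟫_ℂ := rfl

/-- The functional of a nonzero vector in the universal representation is a multiple of a state. -/
theorem exists_state_inner_universalRep {v : UniversalSpace A} (hv : v ≠ 0) :
    ∃ φ : CStarState A, ∀ a, ⟪v, universalRep A a v⟫_ℂ = (‖v‖ ^ 2 : ℝ) * φ.1 a := by
  have hn : (‖v‖ : ℂ) ≠ 0 := by simpa using hv
  refine ⟨⟨universalVectorFunctional ((‖v‖⁻¹ : ℂ) • v), ?_⟩, fun a => ?_⟩
  · rw [universalVectorFunctional_apply, map_one, one_apply_eq_self,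
      inner_smul_left, inner_smul_right, inner_self_eq_norm_sq_to_K]
    simp
    field_simp
  · simp only [universalVectorFunctional_apply, map_smul, inner_smul_left, inner_smul_right]
    simp
    field_simp

/-- Every state is a vector functional of the universal representation. -/
theorem exists_inner_universalRep_eq (φ : CStarState A) :
    ∃ v : UniversalSpace A, ∀ a, ⟪v, universalRep A a v⟫_ℂ = φ.1 a := by
  classical
  -- The GNS cyclic vector of `φ`, the class of `1`, placed in the summand indexed by `φ`.
  refine ⟨lp.single 2 φ ((φ.1.toPreGNS 1 : φ.1.PreGNS) : φ.1.GNS), fun a => ?_⟩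
  rw [lp.inner_single_left]
  change ⟪_, universalRepCLM a _ φ⟫_ℂ = _
  rw [universalRepCLM_apply, lp.single_apply_self]
  simp [PositiveLinearMap.preGNS_inner_def]

theorem mem_universalEnvelopingVonNeumannAlgebra_of_tendsto {ι : Type*} {l : Filter ι} [l.NeBot]
    {a : ι → A} {S : UniversalSpace A →L[ℂ] UniversalSpace A}
    (h : ∀ v w, Tendsto (fun i => ⟪v, universalRep A (a i) w⟫_ℂ) l (𝓝 ⟪v, S w⟫_ℂ)) :
    S ∈ universalEnvelopingVonNeumannAlgebra A := by
  rw [← SetLike.mem_coe, coe_universalEnvelopingVonNeumannAlgebra]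
  exact fun R hR => (commute_of_tendsto_inner (fun i => hR _ ⟨a i, rfl⟩) h).eq.symm

theorem inner_universalRep_sum {J : Type*} (b : J → A) (F : Finset J) (v w : UniversalSpace A) :
    ⟪v, (∑ j ∈ F, universalRep A (b j)) w⟫_ℂ = ∑ j ∈ F, ⟪v, universalRep A (b j) w⟫_ℂ := by
  rw [sum_apply, inner_sum]

/-- Bounds on sums in the universal enveloping von Neumann algebra can be tested on states. -/
theorem exists_ultraweak_sum_iff {J : Type*} {b : J → A} (hb : ∀ j, 0 ≤ b j) (c d : A) :
    (∃ s ∈ universalEnvelopingVonNeumannAlgebra A,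
      Tendsto (fun F : Finset J => ∑ j ∈ F, universalRep A (b j)) atTop
        (@nhds _ (ultraweakTopology (UniversalSpace A)) s) ∧
      universalRep A c ≤ s ∧ s ≤ universalRep A d) ↔
    ∀ φ : CStarState A, Summable (fun j => φ.1 (b j)) ∧
      φ.1 c ≤ ∑' j, φ.1 (b j) ∧ ∑' j, φ.1 (b j) ≤ φ.1 d := by
  constructor
  · rintro ⟨s, -, hs, hcs, hsd⟩ φ
    obtain ⟨v, hv⟩ := exists_inner_universalRep_eq φ
    have h : HasSum (fun j => φ.1 (b j)) ⟪v, s v⟫_ℂ := by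
      have := tendsto_inner_of_tendsto_ultraweakTopology hs v v
      simp only [inner_universalRep_sum, hv] at this
      exact this
    rw [h.tsum_eq, ← hv, ← hv]
    exact ⟨h.summable, le_iff_forall_inner_le.1 hcs v, le_iff_forall_inner_le.1 hsd v⟩
  · intro h
    have hvec (v : UniversalSpace A) : Summable (fun j => ⟪v, universalRep A (b j) v⟫_ℂ) ∧
        ⟪v, universalRep A c v⟫_ℂ ≤ ∑' j, ⟪v, universalRep A (b j) v⟫_ℂ ∧
        ∑' j, ⟪v, universalRep A (b j) v⟫_ℂ ≤ ⟪v, universalRep A d v⟫_ℂ := by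
      rcases eq_or_ne v 0 with rfl | hv
      · simp [summable_zero]
      obtain ⟨φ, hφ⟩ := exists_state_inner_universalRep hv
      obtain ⟨h1, h2, h3⟩ := h φ
      have h0 : (0 : ℂ) ≤ (‖v‖ ^ 2 : ℝ) := Complex.zero_le_real.2 (by positivity)
      simp only [hφ, h1.tsum_mul_left]
      exact ⟨h1.mul_left _, mul_le_mul_of_nonneg_left h2 h0, mul_le_mul_of_nonneg_left h3 h0⟩
    have hpos (j : J) : 0 ≤ universalRep A (b j) := map_nonneg _ (hb j)
    -- At each vector the terms are nonnegative, so a partial sum is at most the full sum.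
    have hB (F : Finset J) : ∑ j ∈ F, universalRep A (b j) ≤ universalRep A d := by
      refine le_iff_forall_inner_le.2 fun v => ?_
      obtain ⟨h1, -, h3⟩ := hvec v
      rw [inner_universalRep_sum]
      exact (h1.sum_le_tsum F fun j _ =>
        ((ContinuousLinearMap.nonneg_iff_isPositive _).1 (hpos j)).inner_nonneg_right v).trans h3
    obtain ⟨s, hs⟩ := exists_hasSum_apply_of_nonneg_of_sum_le hpos hB
    have hsum (v w : UniversalSpace A) :
        HasSum (fun j => ⟪v, universalRep A (b j) w⟫_ℂ) ⟪v, s w⟫_ℂ :=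
      (hs w).mapL (innerSL ℂ v)
    have hlim (v w : UniversalSpace A) :
        Tendsto (fun F : Finset J => ⟪v, (∑ j ∈ F, universalRep A (b j)) w⟫_ℂ) atTop
          (𝓝 ⟪v, s w⟫_ℂ) := by
      simp only [inner_universalRep_sum]
      exact hsum v w
    refine ⟨s, mem_universalEnvelopingVonNeumannAlgebra_of_tendsto
      (a := fun F : Finset J => ∑ j ∈ F, b j) (l := atTop) ?_,
      tendsto_ultraweakTopology_of_bounded (M := ‖universalRep A d‖) (fun F => ?_) hlim, ?_, ?_⟩
    · simpa only [map_sum] using hlim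
    · exact CStarAlgebra.norm_le_norm_of_nonneg_of_le (Finset.sum_nonneg fun j _ => hpos j) (hB F)
    · exact le_iff_forall_inner_le.2 fun v => (hsum v v).tsum_eq ▸ (hvec v).2.1
    · exact le_iff_forall_inner_le.2 fun v => (hsum v v).tsum_eq ▸ (hvec v).2.2

end UniversalRep

theorem proposition3p1 {A X J : Type*} [CStarAlgebra A] [PartialOrder A] [StarOrderedRing A]
    [NormedAddCommGroup X] [Module ℂ X] [Module Aᵐᵒᵖ X] [RightHilbertModule A X] (x : J → X) :
    IsHilbertModuleFrame A x ↔
      ∃ C : ℝ, 0 < C ∧ ∀ (y : X) (φ : CStarState A),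
        Summable (fun j => φ.1 (⟪y, x j⟫_A * ⟪x j, y⟫_A)) ∧
        C * φ.1 ⟪y, y⟫_A ≤ ∑' j, φ.1 (⟪y, x j⟫_A * ⟪x j, y⟫_A) ∧
        ∑' j, φ.1 (⟪y, x j⟫_A * ⟪x j, y⟫_A) ≤ C⁻¹ * φ.1 ⟪y, y⟫_A := by
  have hb (y : X) (j : J) : 0 ≤ ⟪y, x j⟫_A * ⟪x j, y⟫_A := by
    rw [← RightHilbertModule.star_inner (x j) y]
    exact star_mul_self_nonneg _
  refine exists_congr fun C => and_congr_right fun _ => forall_congr' fun y => ?_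
  rw [exists_ultraweak_sum_iff (hb y)]
  simp only [PositiveLinearMap.map_smul_of_tower, Complex.real_smul, Complex.ofReal_inv]
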